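/- For finite simple graphs $F$ and $G$, let $\hom(F,G)$ be the number of graph homomorphisms from $F$ to $G$. A sequence of graphs $(G_n)_{n\ge 0}$ with $|V(G_n)|=n$ is quasirandom with density $p$ if $|E(G_n[U])| = p\binom{|U|}{2}+o(n^2)$ uniformly over all $U\subseteq V(G_n)$. A set $\mathcal{H}$ of finite graphs is called forcing if, for every $p\in(0,1)$ and every sequence of graphs $(G_n)_{n\ge 0}$ with $|V(G_n)|=n$ such that $\hom(H,G_n)=(p^{|E(H)|}+o(1))\,n^{|V(H)|}$ as $n\to\infty$ for every $H\in\mathcal{H}$, the sequence $(G_n)$ is quasirandom with density $p$. Theorem. There exist three pairwise non-isomorphic connected finite graphs $H_1,H_2,H_3$ such that the set $\{H_1,H_2,H_3\}$ is forcing, but none of the three pairs $\{H_1,H_2\}$, $\{H_1,H_3\}$, $\{H_2,H_3\}$ is forcing. -/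

import Mathlib

open Filter Topology

namespace ForcingTriples

/-- A finite simple graph, together with its vertex set. -/
structure FiniteGraph where
  /-- the vertex set -/
  V : Type
  [fintypeV : Fintype V]
  /-- the graph on the vertex set -/
  graph : SimpleGraph V

attribute [instance] FiniteGraph.fintypeV

/-- `t(F, G)`: the probability that a uniformly random map `V(F) → W` is a graph homomorphism
from `F` to `G`, that is `hom(F, G) / |W| ^ |V(F)|`. -/
noncomputable def homDensity (F : FiniteGraph) {W : Type} [Fintype W] (G : SimpleGraph W) : ℝ :=
  (Nat.card (F.graph →g G) : ℝ) / (Fintype.card W : ℝ) ^ Fintype.card F.V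

/-- The graph sequence `G` (with `|V(G n)| = n`) has the homomorphism density `p ^ |E(F)|`
of `F` in the limit: `hom(F, G n) = (p ^ |E(F)| + o(1)) n ^ |V(F)|`. -/
def HasRandomDensity (G : ∀ n : ℕ, SimpleGraph (Fin n)) (p : ℝ) (F : FiniteGraph) : Prop :=
  Tendsto (fun n => homDensity F (G n)) atTop (𝓝 (p ^ F.graph.edgeSet.ncard))

/-- The graph sequence `G` (with `|V(G n)| = n`) is quasirandom with density `p`:
`|E(G n[U])| = p * (|U| choose 2) + o(n ^ 2)`, uniformly over all vertex sets `U` of `G n`. -/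
def IsQuasirandom (G : ∀ n : ℕ, SimpleGraph (Fin n)) (p : ℝ) : Prop :=
  ∀ ε : ℝ, 0 < ε → ∀ᶠ n : ℕ in atTop, ∀ U : Finset (Fin n),
    |(((G n).induce (U : Set (Fin n))).edgeSet.ncard : ℝ) - p * (U.card.choose 2 : ℝ)|
      ≤ ε * (n : ℝ) ^ 2

/-- A set of graphs is forcing if for every graph sequence and every constant `p` in `(0, 1)`,
having the density `p ^ |E(H)|` for all `H` in the set implies quasirandomness. -/
def IsForcing (𝓗 : Set FiniteGraph) : Prop :=
  ∀ (G : ∀ n : ℕ, SimpleGraph (Fin n)) (p : ℝ), 0 < p → p < 1 →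
    (∀ H ∈ 𝓗, HasRandomDensity G p H) → IsQuasirandom G p

end ForcingTriples

/-! The three graphs are the 4-cycle, the 6-cycle and two 6-cycles glued at a vertex. With `M` the
adjacency matrix divided by `n`, their densities are the trace of `M ^ 4`, the trace of `M ^ 6`, and
`n` times the sum of the squares of the diagonal entries of `M ^ 6` (`natCard_hom_rose`).

Forcing. If the sums of fourth and sixth powers of the eigenvalues tend to `p ^ 4` and `p ^ 6`, the
largest absolute value of an eigenvalue `l` tends to `p` and all other eigenvalues are negligible,
so `M` is nearly `l` times the projection onto a unit eigenvector `v` (`exists_rank_one_approx`).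
The third density says that the diagonal of `M ^ 6` has vanishing relative variance, which makes `|v
x|` nearly constant (`sum_abs_sq_sub_inv_card_le`). Even cycles do not see the signs of `l` and of
the entries of `v`. These follow from the nonnegativity of `M`: replacing `v` by `|v|`, hence nearly
by the constant unit vector, cannot lower the quadratic form below about `|l|`. So `M` is close to
the constant matrix `p / n` (`abs_quadForm_sub_le`); indicator vectors then give the edge counts.

Not forcing. A clique on half of the vertices has the right spectrum but a non-constant eigenvector.
A complete bipartite graph has two leading eigenvalues of opposite signs; tuning the size of its
parts matches either cycle together with the glued pair. All these graphs have linear-size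
independent sets. -/

namespace ForcingTriples

open Matrix

/-! ### Spectral estimates: from traces and diagonals to the quadratic form -/

section RankOne

variable {ι : Type*} [Fintype ι]

/-- The spectral theorem for real symmetric matrices, in coordinates. -/
lemma exists_orthonormal_diagonalization [DecidableEq ι] {M : Matrix ι ι ℝ} (hM : M.IsHermitian) :
    ∃ (U : Matrix ι ι ℝ) (d : ι → ℝ), U * Uᵀ = 1 ∧ Uᵀ * U = 1 ∧
      ∀ (k : ℕ) (x y : ι), (M ^ k) x y = ∑ i, d i ^ k * (U x i * U y i) := by
  set U : Matrix ι ι ℝ := hM.eigenvectorUnitary.val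
  have h1 : U * Uᵀ = 1 := by
    have := Unitary.mul_star_self_of_mem hM.eigenvectorUnitary.2
    simpa [star_eq_conjTranspose, conjTranspose_eq_transpose_of_trivial] using this
  have h2 : Uᵀ * U = 1 := mul_eq_one_comm.mp h1
  refine ⟨U, hM.eigenvalues, h1, h2, fun k x y => ?_⟩
  have hs : M = U * diagonal hM.eigenvalues * Uᵀ := by
    have := hM.spectral_theorem
    simpa [Unitary.conjStarAlgAut_apply, star_eq_conjTranspose,
      conjTranspose_eq_transpose_of_trivial, Function.comp_def] using this
  have hk : M ^ k = U * diagonal (fun i => hM.eigenvalues i ^ k) * Uᵀ := by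
    induction k with
    | zero => simp [h1]
    | succ k ih =>
      rw [pow_succ, ih]
      nth_rewrite 2 [hs]
      calc U * diagonal (fun i => hM.eigenvalues i ^ k) * Uᵀ * (U * diagonal hM.eigenvalues * Uᵀ)
          = U * diagonal (fun i => hM.eigenvalues i ^ k) * (Uᵀ * U)
              * diagonal hM.eigenvalues * Uᵀ := by simp only [Matrix.mul_assoc]
        _ = _ := by
          rw [h2, Matrix.mul_one, Matrix.mul_assoc U, diagonal_mul_diagonal]
          simp only [pow_succ]
  rw [hk, Matrix.mul_apply]
  refine Finset.sum_congr rfl fun i _ => ?_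
  rw [Matrix.mul_diagonal, transpose_apply]
  ring

/-- A real symmetric matrix is approximated by its eigenvector of largest eigenvalue. -/
lemma exists_rank_one_approx [DecidableEq ι] [Nonempty ι] {M : Matrix ι ι ℝ}
    (hM : M.IsHermitian) :
    ∃ (l : ℝ) (v : ι → ℝ), v ⬝ᵥ v = 1 ∧ v ⬝ᵥ (M *ᵥ v) = l ∧ l ^ 4 ≤ (M ^ 4).trace ∧
      (M ^ 6).trace ≤ l ^ 2 * (M ^ 4).trace ∧ (∀ x, l ^ 6 * v x ^ 2 ≤ (M ^ 6) x x) ∧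
      ∀ u : ι → ℝ, |u ⬝ᵥ (M *ᵥ u) - l * (v ⬝ᵥ u) ^ 2| ≤
        √√((M ^ 4).trace - l ^ 4) * (u ⬝ᵥ u) := by
  obtain ⟨U, d, h1, h2, hk⟩ := exists_orthonormal_diagonalization hM
  have hcol (i : ι) : ∑ x, U x i * U x i = 1 := by
    have := congrFun (congrFun h2 i) i
    simpa [Matrix.mul_apply] using this
  have htr (k : ℕ) : (M ^ k).trace = ∑ i, d i ^ k := by
    simp only [trace, diag_apply, hk]
    rw [Finset.sum_comm]
    simp only [← Finset.mul_sum, hcol, mul_one]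
  have hpars (u : ι → ℝ) : ∑ i, (fun x => U x i) ⬝ᵥ u * ((fun x => U x i) ⬝ᵥ u) = u ⬝ᵥ u := by
    change (Uᵀ *ᵥ u) ⬝ᵥ (Uᵀ *ᵥ u) = _
    rw [dotProduct_mulVec, vecMul_transpose, mulVec_mulVec, h1, one_mulVec]
  have hquad (u : ι → ℝ) : u ⬝ᵥ (M *ᵥ u) = ∑ i, d i * ((fun x => U x i) ⬝ᵥ u) ^ 2 := by
    have h := hk 1
    simp only [pow_one] at h
    simp only [dotProduct, mulVec, h, sq, Finset.mul_sum, Finset.sum_mul]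
    rw [Finset.sum_comm_cycle]
    refine Finset.sum_congr rfl fun i _ => ?_
    rw [Finset.sum_comm]
    refine Finset.sum_congr rfl fun x _ => Finset.sum_congr rfl fun y _ => ?_
    ring
  obtain ⟨a, -, ha⟩ := Finset.exists_max_image Finset.univ (fun i => d i ^ 2) Finset.univ_nonempty
  have h4 : d a ^ 4 ≤ (M ^ 4).trace := by
    rw [htr]
    exact Finset.single_le_sum (f := fun i => d i ^ 4) (fun i _ => by positivity)
      (Finset.mem_univ a)
  have happrox (u : ι → ℝ) : |u ⬝ᵥ (M *ᵥ u) - d a * ((fun x => U x a) ⬝ᵥ u) ^ 2| ≤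
        √√((M ^ 4).trace - d a ^ 4) * (u ⬝ᵥ u) := by
    rw [hquad, ← Finset.add_sum_erase _ _ (Finset.mem_univ a), add_sub_cancel_left]
    refine (Finset.abs_sum_le_sum_abs _ _).trans ?_
    rw [← hpars u, Finset.mul_sum]
    refine (Finset.sum_le_sum fun i hi => ?_).trans
      (Finset.sum_le_sum_of_subset_of_nonneg (Finset.erase_subset a _) fun i _ _ =>
        mul_nonneg (Real.sqrt_nonneg _) (mul_self_nonneg _))
    rw [abs_mul, abs_of_nonneg (sq_nonneg (_ ⬝ᵥ u)), sq]
    refine mul_le_mul_of_nonneg_right ?_ (mul_self_nonneg _)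
    -- Each other eigenvalue is at most the fourth root of the sum of the remaining fourth powers.
    refine Real.le_sqrt_of_sq_le (Real.le_sqrt_of_sq_le ?_)
    rw [htr, ← Finset.add_sum_erase _ _ (Finset.mem_univ a), add_sub_cancel_left, sq_abs]
    have := Finset.single_le_sum (f := fun i => d i ^ 4) (fun i _ => by positivity) hi
    linarith [show (d i ^ 2) ^ 2 = d i ^ 4 by ring]
  refine ⟨d a, fun x => U x a, hcol a, ?_, h4, ?_, fun x => ?_, happrox⟩
  · rw [hquad, Finset.sum_eq_single a]
    · have : (fun x => U x a) ⬝ᵥ (fun x => U x a) = 1 := hcol a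
      rw [this]; ring
    · intro i _ hi
      have : (fun x => U x i) ⬝ᵥ (fun x => U x a) = 0 := by
        have := congrFun (congrFun h2 i) a
        simpa [Matrix.mul_apply, Matrix.one_apply, hi, dotProduct] using this
      rw [this]; ring
    · simp
  · rw [htr, htr, Finset.mul_sum]
    refine Finset.sum_le_sum fun i _ => ?_
    have := mul_le_mul_of_nonneg_right (ha i (Finset.mem_univ i)) (by positivity : 0 ≤ d i ^ 4)
    simpa [← pow_add] using this
  · rw [hk]
    have := Finset.single_le_sum (f := fun i => d i ^ 6 * (U x i * U x i))
      (fun i _ => mul_nonneg (by positivity) (mul_self_nonneg _)) (Finset.mem_univ a)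
    simpa [sq] using this

/-- The error bound in `abs_quadForm_sub_le`, in terms of the densities and of the leading eigenvalue. -/
noncomputable def quadFormError (p T₄ T₆ S L : ℝ) : ℝ :=
  -- Here `r` bounds the non-leading eigenvalues, `D` the ℓ¹ distance of `v ^ 2` from the uniform
  -- distribution, and `κ` the loss `L * (1 - (v ⬝ᵥ e) ^ 2)` for the constant unit vector `e`.
  let r := √√(T₄ - L ^ 4)
  let D := (√(S - 2 * p ^ 6 * T₆ + p ^ 12) + (T₆ - L ^ 6) + |L ^ 6 - p ^ 6|) / L ^ 6
  let κ := 2 * √D + r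
  r + 2 * L * √(κ / L) + (2 * κ + |L - p|)

lemma abs_dotProduct_le (u w : ι → ℝ) : |u ⬝ᵥ w| ≤ √(u ⬝ᵥ u) * √(w ⬝ᵥ w) := by
  rw [← Real.sqrt_mul (by simpa using dotProduct_self_star_nonneg u)]
  refine Real.abs_le_sqrt ?_
  have := Finset.sum_mul_sq_le_sq_mul_sq Finset.univ u w
  simpa [dotProduct, sq] using this

/-- Entries in `[0, 1/N]` give operator norm at most 1: pass to ℓ¹ norms, each costing a factor
`√N`. -/
lemma abs_dotProduct_mulVec_le {M : Matrix ι ι ℝ} (hM₀ : ∀ x y, 0 ≤ M x y)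
    (hM₁ : ∀ x y, M x y ≤ (Fintype.card ι : ℝ)⁻¹) (u w : ι → ℝ) :
    |u ⬝ᵥ (M *ᵥ w)| ≤ √(u ⬝ᵥ u) * √(w ⬝ᵥ w) := by
  have hone (u : ι → ℝ) : ∑ x, |u x| ≤ √(u ⬝ᵥ u) * √(Fintype.card ι) := by
    have := abs_dotProduct_le (fun x => |u x|) (fun _ => 1)
    simpa [dotProduct, abs_of_nonneg (Finset.sum_nonneg fun x _ => abs_nonneg (u x))] using this
  calc |u ⬝ᵥ (M *ᵥ w)| ≤ ∑ x, ∑ y, |u x| * ((Fintype.card ι : ℝ)⁻¹ * |w y|) := by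
        simp only [dotProduct, mulVec]
        refine (Finset.abs_sum_le_sum_abs _ _).trans (Finset.sum_le_sum fun x _ => ?_)
        rw [abs_mul, ← Finset.mul_sum]
        refine mul_le_mul_of_nonneg_left ?_ (abs_nonneg _)
        refine (Finset.abs_sum_le_sum_abs _ _).trans (Finset.sum_le_sum fun y _ => ?_)
        rw [abs_mul, abs_of_nonneg (hM₀ x y)]
        exact mul_le_mul_of_nonneg_right (hM₁ x y) (abs_nonneg _)
    _ = (Fintype.card ι : ℝ)⁻¹ * ((∑ x, |u x|) * ∑ y, |w y|) := by
        simp only [← Finset.mul_sum, ← Finset.sum_mul]; ring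
    _ ≤ (Fintype.card ι : ℝ)⁻¹ * ((√(u ⬝ᵥ u) * √(Fintype.card ι)) *
          (√(w ⬝ᵥ w) * √(Fintype.card ι))) := by
        gcongr
        · exact hone u
        · exact hone w
    _ = ((Fintype.card ι : ℝ)⁻¹ * (√(Fintype.card ι) * √(Fintype.card ι))) *
          (√(u ⬝ᵥ u) * √(w ⬝ᵥ w)) := by ring
    _ ≤ 1 * (√(u ⬝ᵥ u) * √(w ⬝ᵥ w)) := by
        rw [Real.mul_self_sqrt (Nat.cast_nonneg _)]
        gcongr
        exact inv_mul_le_one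
    _ = _ := one_mul _

/-- Converts ℓ¹ closeness of `v ^ 2` to `1/N` into ℓ² closeness of `|v|` to the constant unit
vector. -/
lemma sub_abs_sq_le (a : ℝ) {b : ℝ} (hb : 0 ≤ b) : (|a| - b) * (|a| - b) ≤ |a ^ 2 - b ^ 2| := by
  rw [← sq_abs a, show |a| ^ 2 - b ^ 2 = (|a| - b) * (|a| + b) by ring, abs_mul,
    abs_of_nonneg (by positivity : 0 ≤ |a| + b), ← abs_mul_abs_self (|a| - b)]
  refine mul_le_mul_of_nonneg_left ?_ (abs_nonneg _)
  rw [abs_le]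
  constructor <;> linarith [abs_nonneg a]

/-- If the diagonal of `M ^ 6` is close to constant and dominated by the leading eigenvector `v`,
then the entries of `v` have nearly constant absolute value. -/
lemma sum_abs_sq_sub_inv_card_le [DecidableEq ι] [Nonempty ι] {M : Matrix ι ι ℝ} {L p : ℝ}
    {v : ι → ℝ} (hL : 0 < L) (hv : v ⬝ᵥ v = 1) (h : ∀ x, L ^ 6 * v x ^ 2 ≤ (M ^ 6) x x) :
    ∑ x, |v x ^ 2 - (Fintype.card ι : ℝ)⁻¹| ≤
      (√(Fintype.card ι * ∑ x, ((M ^ 6) x x) ^ 2 - 2 * p ^ 6 * (M ^ 6).trace + p ^ 12) +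
        ((M ^ 6).trace - L ^ 6) + |L ^ 6 - p ^ 6|) / L ^ 6 := by
  set N : ℝ := (Fintype.card ι : ℝ)
  have hN : 0 < N := Nat.cast_pos.mpr Fintype.card_pos
  have hv' : ∑ x, v x ^ 2 = 1 := by simpa [dotProduct, sq] using hv
  have hconst (c : ℝ) : ∑ _x : ι, c = N * c := by simp [N]
  have h1 : ∑ x, |(M ^ 6) x x - p ^ 6 / N| ≤
      √(N * ∑ x, ((M ^ 6) x x) ^ 2 - 2 * p ^ 6 * (M ^ 6).trace + p ^ 12) := by
    refine Real.le_sqrt_of_sq_le ?_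
    -- Cauchy–Schwarz against the constant 1; expanding the square leaves exactly the expression
    -- under the root.
    have hcs := Finset.sum_mul_sq_le_sq_mul_sq Finset.univ (fun _ : ι => (1 : ℝ))
      (fun x => |(M ^ 6) x x - p ^ 6 / N|)
    simp only [one_mul, one_pow, sq_abs, hconst, mul_one] at hcs
    refine hcs.trans (le_of_eq ?_)
    simp only [sub_sq, Finset.sum_add_distrib, Finset.sum_sub_distrib, hconst, ← Finset.sum_mul,
      ← Finset.mul_sum, trace, diag_apply]
    field_simp
  -- By `h` all differences have the same sign, so the ℓ¹ norm is a difference of traces.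
  have h2 : ∑ x, |L ^ 6 * v x ^ 2 - (M ^ 6) x x| = (M ^ 6).trace - L ^ 6 := by
    simp only [abs_sub_comm _ ((M ^ 6) _ _), abs_of_nonneg (sub_nonneg.mpr (h _)),
      Finset.sum_sub_distrib, ← Finset.mul_sum, hv', mul_one, trace, diag_apply]
  rw [le_div_iff₀ (by positivity), Finset.sum_mul]
  calc ∑ x, |v x ^ 2 - N⁻¹| * L ^ 6
      ≤ ∑ x, (|L ^ 6 * v x ^ 2 - (M ^ 6) x x| + |(M ^ 6) x x - p ^ 6 / N|
          + |L ^ 6 - p ^ 6| / N) := by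
        refine Finset.sum_le_sum fun x _ => ?_
        have hx : |v x ^ 2 - N⁻¹| * L ^ 6 = |(L ^ 6 * v x ^ 2 - (M ^ 6) x x) +
            ((M ^ 6) x x - p ^ 6 / N) + -((L ^ 6 - p ^ 6) / N)| := by
          rw [← abs_of_pos (by positivity : 0 < L ^ 6), ← abs_mul,
            abs_of_pos (by positivity : 0 < L ^ 6)]
          congr 1
          field_simp
          ring
        rw [hx]
        refine (abs_add_three _ _ _).trans (le_of_eq ?_)
        rw [abs_neg, abs_div, abs_of_pos hN]
    _ ≤ _ := by
        rw [Finset.sum_add_distrib, Finset.sum_add_distrib, h2, hconst, mul_div_cancel₀ _ hN.ne']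
        linarith

lemma abs_le_dotProduct_abs_mulVec_abs {M : Matrix ι ι ℝ} (hM₀ : ∀ x y, 0 ≤ M x y) (v : ι → ℝ) :
    |v ⬝ᵥ (M *ᵥ v)| ≤ (fun x => |v x|) ⬝ᵥ (M *ᵥ fun x => |v x|) := by
  simp only [dotProduct, mulVec]
  refine (Finset.abs_sum_le_sum_abs _ _).trans (Finset.sum_le_sum fun x _ => ?_)
  rw [abs_mul]
  refine mul_le_mul_of_nonneg_left ?_ (abs_nonneg _)
  refine (Finset.abs_sum_le_sum_abs _ _).trans (Finset.sum_le_sum fun y _ => ?_)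
  rw [abs_mul, abs_of_nonneg (hM₀ x y)]

/-- If unit vectors `v`, `e` satisfy `(v ⬝ᵥ e) ^ 2 ≈ 1`, then `v` and `e` define nearly the
same rank one quadratic form. -/
lemma abs_dotProduct_sq_sub_le {v e : ι → ℝ} (hv : v ⬝ᵥ v = 1) (he : e ⬝ᵥ e = 1) (u : ι → ℝ) :
    |(v ⬝ᵥ u) ^ 2 - (e ⬝ᵥ u) ^ 2| ≤ 2 * √(1 - (v ⬝ᵥ e) ^ 2) * (u ⬝ᵥ u) := by
  have hu : 0 ≤ u ⬝ᵥ u := by simpa using dotProduct_self_star_nonneg u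
  have e1 : (v ⬝ᵥ u) ^ 2 - (e ⬝ᵥ u) ^ 2 = ((v - e) ⬝ᵥ u) * ((v + e) ⬝ᵥ u) := by
    rw [sub_dotProduct, add_dotProduct]; ring
  have e2 : (v - e) ⬝ᵥ (v - e) = 2 - 2 * (v ⬝ᵥ e) := by
    simp only [sub_dotProduct, dotProduct_sub, hv, he, dotProduct_comm e v]; ring
  have e3 : (v + e) ⬝ᵥ (v + e) = 2 + 2 * (v ⬝ᵥ e) := by
    simp only [add_dotProduct, dotProduct_add, hv, he, dotProduct_comm e v]; ring
  have hnn : 0 ≤ 2 - 2 * (v ⬝ᵥ e) := by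
    rw [← e2]; simpa using dotProduct_self_star_nonneg (v - e)
  rw [e1, abs_mul]
  calc _ ≤ (√((v - e) ⬝ᵥ (v - e)) * √(u ⬝ᵥ u)) * (√((v + e) ⬝ᵥ (v + e)) * √(u ⬝ᵥ u)) :=
        mul_le_mul (abs_dotProduct_le _ _) (abs_dotProduct_le _ _) (abs_nonneg _) (by positivity)
    _ = (√((v - e) ⬝ᵥ (v - e)) * √((v + e) ⬝ᵥ (v + e))) * (√(u ⬝ᵥ u) * √(u ⬝ᵥ u)) := by ring
    _ = _ := by
        rw [Real.mul_self_sqrt hu, e2, e3, ← Real.sqrt_mul hnn,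
          show (2 - 2 * (v ⬝ᵥ e)) * (2 + 2 * (v ⬝ᵥ e)) = 2 ^ 2 * (1 - (v ⬝ᵥ e) ^ 2) by ring,
          Real.sqrt_mul (by norm_num), Real.sqrt_sq (by norm_num)]

/-- A quantitative form of the forcing statement: a bound for the distance of the quadratic form
of `M` from that of the constant matrix `p / N`. -/
lemma abs_quadForm_sub_le [DecidableEq ι] [Nonempty ι] {M : Matrix ι ι ℝ} (hM : M.IsHermitian)
    (hM₀ : ∀ x y, 0 ≤ M x y) (hM₁ : ∀ x y, M x y ≤ (Fintype.card ι : ℝ)⁻¹) (p : ℝ) :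
    ∃ L : ℝ, 0 ≤ L ∧ L ^ 4 ≤ (M ^ 4).trace ∧ (M ^ 6).trace ≤ L ^ 2 * (M ^ 4).trace ∧
      (0 < L → ∀ u : ι → ℝ, |u ⬝ᵥ (M *ᵥ u) - p * ((∑ x, u x) ^ 2 / Fintype.card ι)| ≤
        quadFormError p (M ^ 4).trace (M ^ 6).trace
          (Fintype.card ι * ∑ x, ((M ^ 6) x x) ^ 2) L * (u ⬝ᵥ u)) := by
  obtain ⟨l, v, hv, hvl, h4, h6, hdiag, happrox⟩ := exists_rank_one_approx hM
  have hp4 : |l| ^ 4 = l ^ 4 := Even.pow_abs (by decide) l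
  have hp6 : |l| ^ 6 = l ^ 6 := Even.pow_abs (by decide) l
  refine ⟨|l|, abs_nonneg l, hp4 ▸ h4, by rwa [sq_abs], fun hL u => ?_⟩
  rw [← hp6] at hdiag
  rw [← hp4] at happrox
  have hD := sum_abs_sq_sub_inv_card_le (p := p) hL hv hdiag
  unfold quadFormError
  extract_lets r D κ
  change _ ≤ D at hD
  set N : ℝ := (Fintype.card ι : ℝ) with hNdef
  have hN : 0 < N := Nat.cast_pos.mpr Fintype.card_pos
  set e : ι → ℝ := fun _ => (√N)⁻¹ with hedef
  have heu (u : ι → ℝ) : (e ⬝ᵥ u) ^ 2 = (∑ x, u x) ^ 2 / N := by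
    simp only [hedef, dotProduct, ← Finset.mul_sum, mul_pow, inv_pow, Real.sq_sqrt hN.le]
    ring
  have he : e ⬝ᵥ e = 1 := by
    simp only [hedef, dotProduct, ← mul_inv, Real.mul_self_sqrt hN.le]
    simp [← hNdef, hN.ne']
  set w : ι → ℝ := fun x => |v x| with hwdef
  have hw : w ⬝ᵥ w = 1 := by
    rw [← hv]
    simp [hwdef, dotProduct]
  have hwe : (w - e) ⬝ᵥ (w - e) ≤ D := by
    refine le_trans (Finset.sum_le_sum fun x _ => ?_) hD
    have := sub_abs_sq_le (v x) (inv_nonneg.mpr (Real.sqrt_nonneg N))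
    rwa [inv_pow, Real.sq_sqrt hN.le] at this
  have hw1 : |l| ≤ w ⬝ᵥ (M *ᵥ w) := hvl ▸ abs_le_dotProduct_abs_mulVec_abs hM₀ v
  have hsq := Real.sqrt_le_sqrt hwe
  have hb1 := abs_dotProduct_mulVec_le hM₀ hM₁ (w - e) w
  have hb2 := abs_dotProduct_mulVec_le hM₀ hM₁ e (w - e)
  rw [hw, Real.sqrt_one, mul_one] at hb1
  rw [he, Real.sqrt_one, one_mul] at hb2
  have hsplit : w ⬝ᵥ (M *ᵥ w) = (w - e) ⬝ᵥ (M *ᵥ w) + e ⬝ᵥ (M *ᵥ (w - e)) + e ⬝ᵥ (M *ᵥ e) := by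
    rw [sub_dotProduct, mulVec_sub, dotProduct_sub]; ring
  have hae := happrox e
  rw [he, mul_one] at hae
  -- Replacing `w = |v|` by `e` in both arguments costs `√D` each, and the rank one approximation at
  -- `e` costs `r`.
  have hκ : |l| - l * (v ⬝ᵥ e) ^ 2 ≤ κ := by
    have h1 := le_abs_self ((w - e) ⬝ᵥ (M *ᵥ w))
    have h2 := le_abs_self (e ⬝ᵥ (M *ᵥ (w - e)))
    have h3 := le_abs_self (e ⬝ᵥ (M *ᵥ e) - l * (v ⬝ᵥ e) ^ 2)
    change _ ≤ 2 * √D + r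
    linarith
  have hc1 : (v ⬝ᵥ e) ^ 2 ≤ 1 := by
    have := abs_dotProduct_le v e
    rw [hv, he, Real.sqrt_one, mul_one] at this
    exact (sq_le_one_iff_abs_le_one _).mpr this
  have hc0 := sq_nonneg (v ⬝ᵥ e)
  set c : ℝ := (v ⬝ᵥ e) ^ 2
  have hlow : |l| * (1 - c) ≤ κ := by
    have := mul_le_mul_of_nonneg_right (le_abs_self l) hc0
    linarith
  -- The sign of `l`: if `l` were negative, `hκ` would force `|l| ≤ κ`.
  have hlp : |l - p| ≤ 2 * κ + |(|l| - p)| := by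
    have h1 : |l| - l ≤ 2 * κ := by
      rcases le_or_gt 0 l with hl | hl
      · rw [abs_of_nonneg hl] at hlow ⊢
        nlinarith
      · rw [abs_of_neg hl] at hκ ⊢
        nlinarith
    have h2 : |l - p| ≤ |l - (|l|)| + |(|l| - p)| := abs_sub_le _ _ _
    rw [abs_sub_comm l (|l|), abs_of_nonneg (sub_nonneg.mpr (le_abs_self l))] at h2
    linarith
  have hsqrt : √(1 - c) ≤ √(κ / |l|) :=
    Real.sqrt_le_sqrt ((le_div_iff₀ hL).mpr (by linarith))
  have hu : 0 ≤ u ⬝ᵥ u := by simpa using dotProduct_self_star_nonneg u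
  have hdiff := abs_dotProduct_sq_sub_le hv he u
  have heule : (e ⬝ᵥ u) ^ 2 ≤ u ⬝ᵥ u := by
    have := abs_dotProduct_le e u
    rw [he, Real.sqrt_one, one_mul] at this
    calc (e ⬝ᵥ u) ^ 2 = |e ⬝ᵥ u| ^ 2 := (sq_abs _).symm
      _ ≤ √(u ⬝ᵥ u) ^ 2 := by gcongr
      _ = _ := Real.sq_sqrt hu
  rw [← heu]
  calc |u ⬝ᵥ (M *ᵥ u) - p * (e ⬝ᵥ u) ^ 2|
      = |(u ⬝ᵥ (M *ᵥ u) - l * (v ⬝ᵥ u) ^ 2) + l * ((v ⬝ᵥ u) ^ 2 - (e ⬝ᵥ u) ^ 2)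
          + (l - p) * (e ⬝ᵥ u) ^ 2| := by congr 1; ring
    _ ≤ r * (u ⬝ᵥ u) + |l| * (2 * √(κ / |l|) * (u ⬝ᵥ u))
          + (2 * κ + |(|l| - p)|) * (u ⬝ᵥ u) := by
        refine (abs_add_three _ _ _).trans (add_le_add_three (happrox u) ?_ ?_)
        · rw [abs_mul]
          refine mul_le_mul_of_nonneg_left (hdiff.trans ?_) (abs_nonneg l)
          gcongr
        · rw [abs_mul, abs_of_nonneg (sq_nonneg (e ⬝ᵥ u))]
          exact mul_le_mul hlp heule (sq_nonneg _) ((abs_nonneg _).trans hlp)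
    _ = _ := by ring

end RankOne

/-! ### Cycles glued at a vertex and their homomorphism counts -/

/-- The vertices of the `i`-th cycle of `rose t k`, in order and starting and ending at the
common vertex of the cycles. -/
def petal {t k : ℕ} (i : Fin t) : Fin (k + 2) → Option (Fin t × Fin k) :=
  Fin.cons none (Fin.snoc (α := fun _ => Option (Fin t × Fin k)) (fun j => some (i, j)) none)

/-- `t` cycles of length `k + 1` that share one vertex. -/
def roseGraph (t k : ℕ) : SimpleGraph (Option (Fin t × Fin k)) :=
  SimpleGraph.fromRel fun a b =>
    ∃ (i : Fin t) (j : Fin (k + 1)), a = petal i j.castSucc ∧ b = petal i j.succ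

/-- `t` cycles of length `k + 1` that share one vertex, as a finite graph. -/
def rose (t k : ℕ) : FiniteGraph where
  V := Option (Fin t × Fin k)
  graph := roseGraph t k

lemma card_rose (t k : ℕ) : Fintype.card (rose t k).V = t * k + 1 := by
  change Fintype.card (Option (Fin t × Fin k)) = _
  simp

/-- For `k = 0` the petal would be a loop, which `SimpleGraph.fromRel` discards. -/
lemma petal_castSucc_ne_succ {t k : ℕ} (hk : 0 < k) (i : Fin t) (j : Fin (k + 1)) :
    petal (k := k) i j.castSucc ≠ petal i j.succ := by
  obtain ⟨k, rfl⟩ : ∃ m, k = m + 1 := ⟨k - 1, by omega⟩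
  unfold petal
  rw [Fin.cons_succ]
  cases j using Fin.cases with
  | zero =>
    rw [Fin.castSucc_zero, Fin.cons_zero, ← Fin.castSucc_zero, Fin.snoc_castSucc]
    simp
  | succ j =>
    rw [← Fin.succ_castSucc, Fin.cons_succ, Fin.snoc_castSucc]
    cases j using Fin.lastCases with
    | last => rw [Fin.succ_last, Fin.snoc_last]; simp
    | cast j => rw [Fin.succ_castSucc, Fin.snoc_castSucc]; simp [Fin.ext_iff]

lemma roseGraph_adj_petal {t k : ℕ} (hk : 0 < k) (i : Fin t) (j : Fin (k + 1)) :
    (roseGraph t k).Adj (petal i j.castSucc) (petal i j.succ) :=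
  (SimpleGraph.fromRel_adj _ _ _).mpr ⟨petal_castSucc_ne_succ hk i j, Or.inl ⟨i, j, rfl, rfl⟩⟩

lemma connected_roseGraph {t k : ℕ} (hk : 0 < k) : (roseGraph t k).Connected := by
  have hreach (i : Fin t) (j : Fin (k + 2)) : (roseGraph t k).Reachable none (petal i j) := by
    induction j using Fin.induction with
    | zero => rfl
    | succ j ih => exact ih.trans (roseGraph_adj_petal hk i j).reachable
  rw [SimpleGraph.connected_iff_exists_forall_reachable]
  refine ⟨none, fun a => ?_⟩
  rcases a with _ | ⟨i, j⟩
  · rfl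
  · simpa [petal] using hreach i j.castSucc.succ

instance (t k : ℕ) : DecidableRel (roseGraph t k).Adj := fun a b =>
  decidable_of_iff _ (SimpleGraph.fromRel_adj _ a b).symm

lemma ncard_edgeSet_rose_one_three : (rose 1 3).graph.edgeSet.ncard = 4 := by
  change (roseGraph 1 3).edgeSet.ncard = 4
  rw [← SimpleGraph.coe_edgeFinset, Set.ncard_coe_finset]
  decide

lemma ncard_edgeSet_rose_one_five : (rose 1 5).graph.edgeSet.ncard = 6 := by
  change (roseGraph 1 5).edgeSet.ncard = 6
  rw [← SimpleGraph.coe_edgeFinset, Set.ncard_coe_finset]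
  decide

set_option maxRecDepth 10000 in
lemma ncard_edgeSet_rose_two_five : (rose 2 5).graph.edgeSet.ncard = 12 := by
  change (roseGraph 2 5).edgeSet.ncard = 12
  rw [← SimpleGraph.coe_edgeFinset, Set.ncard_coe_finset]
  decide +kernel

/-- The entries of a power of a matrix as sums over walks, given by their inner vertices. -/
lemma sum_prod_walk_eq_pow {W R : Type*} [Fintype W] [DecidableEq W] [CommSemiring R]
    (A : Matrix W W R) (k : ℕ) (x y : W) :
    ∑ g : Fin k → W, ∏ j : Fin (k + 1),
      A ((Fin.cons x (Fin.snoc (α := fun _ => W) g y) : Fin (k + 2) → W) j.castSucc)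
        ((Fin.cons x (Fin.snoc (α := fun _ => W) g y) : Fin (k + 2) → W) j.succ) =
      (A ^ (k + 1)) x y := by
  induction k generalizing x with
  | zero =>
    simp
    rfl
  | succ k ih =>
    rw [pow_succ', Matrix.mul_apply, ← (Fin.consEquiv fun _ => W).sum_comp, Fintype.sum_prod_type]
    refine Finset.sum_congr rfl fun z _ => ?_
    rw [← ih, Finset.mul_sum]
    refine Finset.sum_congr rfl fun g _ => ?_
    rw [Fin.prod_univ_succ]
    have h : (Fin.snoc (α := fun _ => W) ((Fin.consEquiv fun _ => W) (z, g)) y : Fin (k + 2) → W) =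
        Fin.cons z (Fin.snoc (α := fun _ => W) g y) := (Fin.cons_snoc_eq_snoc_cons ..).symm
    rw [h]
    rfl

/-- A homomorphism is an image `x` of the common vertex and `t` independent closed walks of length
`k + 1` at `x`. -/
lemma natCard_hom_rose {W : Type} [Fintype W] [DecidableEq W] (G : SimpleGraph W)
    [DecidableRel G.Adj] {t k : ℕ} (hk : 0 < k) :
    (Nat.card ((rose t k).graph →g G) : ℝ) = ∑ x, ((G.adjMatrix ℝ ^ (k + 1)) x x) ^ t := by
  classical
  have e1 : ((rose t k).graph →g G) ≃ {f : Option (Fin t × Fin k) → W //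
      ∀ i : Fin t, ∀ j : Fin (k + 1), G.Adj (f (petal i j.castSucc)) (f (petal i j.succ))} :=
    { toFun := fun f => ⟨f, fun i j => f.map_rel (roseGraph_adj_petal hk i j)⟩
      invFun := fun f => ⟨f.1, fun {a b} h => by
        rcases ((SimpleGraph.fromRel_adj _ _ _).mp h).2 with ⟨i, j, rfl, rfl⟩ | ⟨i, j, rfl, rfl⟩
        · exact f.2 i j
        · exact (f.2 i j).symm⟩
      left_inv := fun _ => rfl
      right_inv := fun _ => rfl }
  let e2 : (Option (Fin t × Fin k) → W) ≃ W × (Fin t → Fin k → W) :=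
    (Equiv.piOptionEquivProd).trans ((Equiv.refl W).prodCongr (Equiv.curry _ _ _))
  have hpetal (f : Option (Fin t × Fin k) → W) (i : Fin t) (j : Fin (k + 2)) :
      f (petal i j) = (Fin.cons (e2 f).1 (Fin.snoc (α := fun _ => W) ((e2 f).2 i) (e2 f).1) :
        Fin (k + 2) → W) j := by
    unfold petal
    cases j using Fin.cases with
    | zero => rfl
    | succ j =>
      cases j using Fin.lastCases with
      | last => simp [e2]
      | cast j => simp [e2]
  have hind (f : Option (Fin t × Fin k) → W) :
      (if ∀ i : Fin t, ∀ j : Fin (k + 1), G.Adj (f (petal i j.castSucc)) (f (petal i j.succ))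
        then (1 : ℝ) else 0) = ∏ i, ∏ j : Fin (k + 1),
        G.adjMatrix ℝ (f (petal i j.castSucc)) (f (petal i j.succ)) := by
    simp only [SimpleGraph.adjMatrix_apply, Finset.prod_ite_zero, Finset.mem_univ, true_imp_iff,
      Finset.prod_const_one]
  rw [Nat.card_congr e1, Nat.card_eq_fintype_card, Fintype.card_subtype,
    Finset.card_eq_sum_ones, Nat.cast_sum, Finset.sum_filter]
  simp only [Nat.cast_one]
  rw [Finset.sum_congr rfl fun f _ => (by convert hind f)]
  simp only [hpetal]
  rw [e2.sum_comp (fun q => ∏ i, ∏ j : Fin (k + 1), G.adjMatrix ℝ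
    ((Fin.cons q.1 (Fin.snoc (α := fun _ => W) (q.2 i) q.1) : Fin (k + 2) → W) j.castSucc)
    ((Fin.cons q.1 (Fin.snoc (α := fun _ => W) (q.2 i) q.1) : Fin (k + 2) → W) j.succ)),
    Fintype.sum_prod_type]
  refine Finset.sum_congr rfl fun x _ => ?_
  rw [← sum_prod_walk_eq_pow, ← Fin.prod_const, Finset.prod_univ_sum]
  simp

lemma homDensity_rose {n : ℕ} (G : SimpleGraph (Fin n)) [DecidableRel G.Adj] {t k : ℕ}
    (hk : 0 < k) : homDensity (rose t k) G =
      (∑ x, ((G.adjMatrix ℝ ^ (k + 1)) x x) ^ t) / (n : ℝ) ^ (t * k + 1) := by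
  rw [homDensity, natCard_hom_rose G hk, card_rose, Fintype.card_fin]

/-! ### Edge counts, limits and the forcing statement -/

lemma two_mul_ncard_edgeSet_induce {n : ℕ} (G : SimpleGraph (Fin n)) [DecidableRel G.Adj] (U : Finset (Fin n)) :
    2 * ((G.induce (U : Set (Fin n))).edgeSet.ncard : ℝ) =
      (fun x => if x ∈ U then 1 else 0) ⬝ᵥ
        (G.adjMatrix ℝ *ᵥ (fun x => if x ∈ U then 1 else 0)) := by
  classical
  have h := (G.induce (U : Set (Fin n))).sum_degrees_eq_twice_card_edges
  rw [← SimpleGraph.coe_edgeFinset, Set.ncard_coe_finset]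
  have h' : (2 * ((G.induce (U : Set (Fin n))).edgeFinset.card : ℝ)) =
      ∑ x : (U : Set (Fin n)), ((G.induce (U : Set (Fin n))).degree x : ℝ) := by
    exact_mod_cast h.symm
  rw [h']
  simp only [dotProduct, ite_mul, one_mul, zero_mul, mulVec, mul_ite, mul_one, mul_zero,
    Finset.sum_ite_mem, Finset.univ_inter]
  rw [← Finset.sum_coe_sort U]
  refine Finset.sum_congr rfl fun x _ => ?_
  rw [← Finset.sum_coe_sort U]
  simp [← SimpleGraph.card_neighborFinset_eq_degree, SimpleGraph.neighborFinset_eq_filter,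
    SimpleGraph.adjMatrix_apply]

/-- The error is continuous at the limiting arguments, where every term of it vanishes. -/
lemma tendsto_quadFormError {T₄ T₆ S L : ℕ → ℝ} {p : ℝ} (hp : 0 < p)
    (h₄ : Tendsto T₄ atTop (𝓝 (p ^ 4))) (h₆ : Tendsto T₆ atTop (𝓝 (p ^ 6)))
    (hS : Tendsto S atTop (𝓝 (p ^ 12))) (hL : Tendsto L atTop (𝓝 p)) :
    Tendsto (fun n => quadFormError p (T₄ n) (T₆ n) (S n) (L n)) atTop (𝓝 0) := by
  have hcont : ContinuousAt (fun q : ℝ × ℝ × ℝ × ℝ => quadFormError p q.1 q.2.1 q.2.2.1 q.2.2.2)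
      (p ^ 4, p ^ 6, p ^ 12, p) := by
    unfold quadFormError
    have : p ^ 6 ≠ 0 := by positivity
    fun_prop (disch := first | assumption | exact hp.ne')
  have h0 : quadFormError p (p ^ 4) (p ^ 6) (p ^ 12) p = 0 := by
    have : p ^ 12 - 2 * p ^ 6 * p ^ 6 + p ^ 12 = 0 := by ring
    simp [quadFormError, this]
  rw [← h0]
  exact hcont.tendsto.comp (h₄.prodMk_nhds (h₆.prodMk_nhds (hS.prodMk_nhds hL)))

lemma homDensity_rose_one {n : ℕ} (G : SimpleGraph (Fin n)) [DecidableRel G.Adj] {k : ℕ}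
    (hk : 0 < k) : homDensity (rose 1 k) G =
      (((n : ℝ)⁻¹ • G.adjMatrix ℝ) ^ (k + 1)).trace := by
  rw [homDensity_rose G hk, smul_pow, trace_smul, smul_eq_mul, inv_pow, div_eq_inv_mul, one_mul]
  simp [trace]

lemma homDensity_rose_two {n : ℕ} (G : SimpleGraph (Fin n)) [DecidableRel G.Adj] {k : ℕ}
    (hk : 0 < k) (hn : n ≠ 0) : homDensity (rose 2 k) G =
      n * ∑ x, ((((n : ℝ)⁻¹ • G.adjMatrix ℝ) ^ (k + 1)) x x) ^ 2 := by
  have : (n : ℝ) ≠ 0 := Nat.cast_ne_zero.mpr hn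
  simp only [homDensity_rose G hk, smul_pow, Matrix.smul_apply, smul_eq_mul, mul_pow,
    ← Finset.mul_sum]
  rw [div_eq_iff (by positivity), show 2 * k + 1 = (k + 1) * 2 - 1 by omega]
  have h : (n : ℝ) * (n : ℝ) ^ ((k + 1) * 2 - 1) = (n ^ (k + 1)) ^ 2 := by
    rw [← pow_succ', ← pow_mul]; congr 1
  calc _ = (((n : ℝ)⁻¹ ^ (k + 1)) ^ 2 * ((n : ℝ) ^ (k + 1)) ^ 2) *
        ∑ x, ((G.adjMatrix ℝ ^ (k + 1)) x x) ^ 2 := by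
        rw [← mul_pow, ← mul_pow, inv_mul_cancel₀ this]; simp
    _ = _ := by rw [← h]; ring

lemma exists_abs_edges_sub_le {n : ℕ} (hn : n ≠ 0) (G : SimpleGraph (Fin n)) (p : ℝ) :
    ∃ L : ℝ, 0 ≤ L ∧ L ^ 4 ≤ homDensity (rose 1 3) G ∧
      homDensity (rose 1 5) G ≤ L ^ 2 * homDensity (rose 1 3) G ∧
      (0 < L → ∀ U : Finset (Fin n),
        |2 * ((G.induce (U : Set (Fin n))).edgeSet.ncard : ℝ) - p * (U.card : ℝ) ^ 2| ≤
        quadFormError p (homDensity (rose 1 3) G) (homDensity (rose 1 5) G)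
          (homDensity (rose 2 5) G) L * U.card * n) := by
  classical
  have hn' : (0 : ℝ) < n := Nat.cast_pos.mpr (Nat.pos_of_ne_zero hn)
  have : Nonempty (Fin n) := ⟨⟨0, Nat.pos_of_ne_zero hn⟩⟩
  have hherm : ((n : ℝ)⁻¹ • G.adjMatrix ℝ).IsHermitian := by
    rw [IsHermitian, conjTranspose_eq_transpose_of_trivial, transpose_smul,
      SimpleGraph.transpose_adjMatrix]
  obtain ⟨L, hL, h4, h6, hU⟩ := abs_quadForm_sub_le hherm
    (fun x y => by
      rw [Matrix.smul_apply, SimpleGraph.adjMatrix_apply]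
      split_ifs <;> simp)
    (fun x y => by
      rw [Matrix.smul_apply, SimpleGraph.adjMatrix_apply, Fintype.card_fin]
      split_ifs <;> simp) p
  rw [homDensity_rose_one G (by norm_num), homDensity_rose_one G (by norm_num),
    homDensity_rose_two G (by norm_num) hn]
  refine ⟨L, hL, h4, h6, fun hpos U => ?_⟩
  have h := hU hpos (fun x => if x ∈ U then 1 else 0)
  have huu : ((fun x => if x ∈ U then 1 else 0) ⬝ᵥ (fun x => if x ∈ U then 1 else 0) : ℝ) =
      U.card := by simp [dotProduct]
  rw [huu, smul_mulVec, dotProduct_smul, ← two_mul_ncard_edgeSet_induce, smul_eq_mul,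
    Fintype.card_fin] at h
  have hsum : (∑ x, if x ∈ U then (1 : ℝ) else 0) = U.card := by simp
  rw [hsum] at h
  have e : 2 * ((G.induce (U : Set (Fin n))).edgeSet.ncard : ℝ) - p * (U.card : ℝ) ^ 2 =
      ((n : ℝ)⁻¹ * (2 * ((G.induce (U : Set (Fin n))).edgeSet.ncard : ℝ)) -
        p * ((U.card : ℝ) ^ 2 / n)) * n := by
    field_simp
  rw [e, abs_mul, abs_of_pos hn']
  exact mul_le_mul_of_nonneg_right h hn'.le

/-- Squeeze `T₆ / T₄ ≤ L ^ 2 ≤ √T₄`; both ends tend to `p ^ 2`. -/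
lemma tendsto_of_pow_bounds {T₄ T₆ L : ℕ → ℝ} {p : ℝ} (hp : 0 < p)
    (h₄ : Tendsto T₄ atTop (𝓝 (p ^ 4))) (h₆ : Tendsto T₆ atTop (𝓝 (p ^ 6)))
    (hL : ∀ᶠ n in atTop, 0 ≤ L n ∧ L n ^ 4 ≤ T₄ n ∧ T₆ n ≤ L n ^ 2 * T₄ n) :
    Tendsto L atTop (𝓝 p) := by
  have hsq : Tendsto (fun n => L n ^ 2) atTop (𝓝 (p ^ 2)) := by
    have hlow : Tendsto (fun n => T₆ n / T₄ n) atTop (𝓝 (p ^ 2)) := by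
      have := h₆.div h₄ (by positivity)
      rwa [show p ^ 6 / p ^ 4 = p ^ 2 by field_simp] at this
    have hupp : Tendsto (fun n => √(T₄ n)) atTop (𝓝 (p ^ 2)) := by
      have := h₄.sqrt
      rwa [show p ^ 4 = (p ^ 2) ^ 2 by ring, Real.sqrt_sq (by positivity)] at this
    refine tendsto_of_tendsto_of_tendsto_of_le_of_le' hlow hupp ?_ ?_
    · filter_upwards [hL, h₄.eventually (lt_mem_nhds (by positivity : 0 < p ^ 4))] with n hn hpos
      exact (div_le_iff₀ hpos).mpr hn.2.2
    · filter_upwards [hL] with n hn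
      exact Real.le_sqrt_of_sq_le (by simpa [← pow_mul] using hn.2.1)
  have h := hsq.sqrt
  rw [Real.sqrt_sq hp.le] at h
  refine h.congr' ?_
  filter_upwards [hL] with n hn
  exact Real.sqrt_sq hn.1

/-- The 4-cycle, the 6-cycle and the union of two 6-cycles that share one vertex force
quasirandomness. -/
theorem isForcing_roses : IsForcing {rose 1 3, rose 1 5, rose 2 5} := by
  intro G p hp0 hp1 hG
  have h4 : Tendsto (fun n => homDensity (rose 1 3) (G n)) atTop (𝓝 (p ^ 4)) := by
    have := hG (rose 1 3) (by simp)
    rwa [HasRandomDensity, ncard_edgeSet_rose_one_three] at this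
  have h6 : Tendsto (fun n => homDensity (rose 1 5) (G n)) atTop (𝓝 (p ^ 6)) := by
    have := hG (rose 1 5) (by simp)
    rwa [HasRandomDensity, ncard_edgeSet_rose_one_five] at this
  have hS : Tendsto (fun n => homDensity (rose 2 5) (G n)) atTop (𝓝 (p ^ 12)) := by
    have := hG (rose 2 5) (by simp)
    rwa [HasRandomDensity, ncard_edgeSet_rose_two_five] at this
  -- The estimate needs `n ≠ 0`; the default value 0 at `n = 0` makes `L` a total sequence.
  have hex := fun n : ℕ => (Classical.em (n ≠ 0)).elim
    (fun hn => (exists_abs_edges_sub_le hn (G n) p).imp fun _ h (_ : n ≠ 0) => h)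
    (fun hn => ⟨0, fun h => absurd h hn⟩)
  choose L hL using hex
  have hne : ∀ᶠ n : ℕ in atTop, n ≠ 0 := eventually_ne_atTop 0
  have hLp : Tendsto L atTop (𝓝 p) := by
    refine tendsto_of_pow_bounds hp0 h4 h6 ?_
    filter_upwards [hne] with n hn
    exact ⟨(hL n hn).1, (hL n hn).2.1, (hL n hn).2.2.1⟩
  have herr := tendsto_quadFormError hp0 h4 h6 hS hLp
  intro ε hε
  have hinv : Tendsto (fun n : ℕ => (n : ℝ)⁻¹) atTop (𝓝 0) := tendsto_inv_atTop_nhds_zero_nat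
  filter_upwards [hne, hLp.eventually (lt_mem_nhds hp0), herr.eventually (gt_mem_nhds hε),
    hinv.eventually (gt_mem_nhds hε)] with n hn hLpos hB hnε U
  have hn' : (0 : ℝ) < n := Nat.cast_pos.mpr (Nat.pos_of_ne_zero hn)
  have h := (hL n hn).2.2.2 hLpos U
  have hcard : (U.card : ℝ) ≤ n := by
    have := Finset.card_le_univ U
    rw [Fintype.card_fin] at this
    exact_mod_cast this
  have hU0 : (0 : ℝ) ≤ U.card := Nat.cast_nonneg _
  have h1 : quadFormError p (homDensity (rose 1 3) (G n)) (homDensity (rose 1 5) (G n))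
      (homDensity (rose 2 5) (G n)) (L n) * U.card * n ≤ ε * n ^ 2 := by
    calc _ ≤ ε * U.card * n := by gcongr
      _ ≤ ε * n * n := by gcongr
      _ = _ := by ring
  -- Accounts for the gap between `|U| ^ 2` and `2 * (|U| choose 2)`.
  have h2 : p * U.card ≤ ε * n ^ 2 := by
    have : 1 ≤ ε * n := by
      have := mul_le_mul_of_nonneg_right hnε.le hn'.le
      rwa [inv_mul_cancel₀ hn'.ne'] at this
    calc p * U.card ≤ 1 * n := by gcongr
      _ ≤ (ε * n) * n := by gcongr
      _ = _ := by ring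
  have h3 : 0 ≤ p * U.card := by positivity
  have h4 := abs_le.mp (h.trans h1)
  rw [Nat.cast_choose_two, abs_le]
  constructor <;> nlinarith [h4.1, h4.2]

/-! ### Counterexample sequences: bicliques and cliques -/

/-- Graphs with linear-size independent sets are not quasirandom with positive density. -/
lemma not_isQuasirandom_of_independent {G : ∀ n : ℕ, SimpleGraph (Fin n)} {p : ℝ} (hp : 0 < p)
    (h : ∀ n : ℕ, ∃ U : Finset (Fin n), n / 4 ≤ U.card ∧ ∀ x ∈ U, ∀ y ∈ U, ¬ (G n).Adj x y) :
    ¬ IsQuasirandom G p := by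
  intro hq
  -- For `n ≥ 40` one has `|U| ≥ n / 5`, so `|U| choose 2` exceeds `n ^ 2 / 200`.
  have hev := (hq (p / 200) (by positivity)).and (eventually_ge_atTop 40)
  obtain ⟨n, hn, hn40⟩ := hev.exists
  obtain ⟨U, hU, hind⟩ := h n
  have hempty : (G n).induce (U : Set (Fin n)) = ⊥ := by
    ext x y
    simpa using hind x x.2 y y.2
  have := hn U
  rw [hempty, SimpleGraph.edgeSet_bot, Set.ncard_empty, Nat.cast_zero, zero_sub, abs_neg,
    Nat.cast_choose_two] at this
  have h1 := (le_abs_self _).trans this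
  have hUn : (n : ℝ) ≤ 5 * U.card := by
    have : n ≤ 5 * U.card := by omega
    exact_mod_cast this
  have hn40' : (40 : ℝ) ≤ n := by exact_mod_cast hn40
  have h2 : (U.card : ℝ) * (U.card - 1) / 2 ≤ 1 / 200 * (n : ℝ) ^ 2 := by
    have : p * ((U.card : ℝ) * (U.card - 1) / 2) ≤ p * (1 / 200 * (n : ℝ) ^ 2) := by linarith
    exact le_of_mul_le_mul_left this hp
  nlinarith

/-- The complete bipartite graph with parts `{0, …, m - 1}` and `{m, …, 2 * m - 1}` and further
isolated vertices. -/
def bicliqueGraph (n m : ℕ) : SimpleGraph (Fin n) :=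
  SimpleGraph.fromRel fun x y => x.val < m ∧ m ≤ y.val ∧ y.val < 2 * m

/-- The complete graph on `{0, …, m - 1}` with further isolated vertices. -/
def cliqueGraph (n m : ℕ) : SimpleGraph (Fin n) :=
  SimpleGraph.fromRel fun x y => x.val < m ∧ y.val < m

instance (n m : ℕ) : DecidableRel (bicliqueGraph n m).Adj := fun a b =>
  decidable_of_iff _ (SimpleGraph.fromRel_adj _ a b).symm

instance (n m : ℕ) : DecidableRel (cliqueGraph n m).Adj := fun a b =>
  decidable_of_iff _ (SimpleGraph.fromRel_adj _ a b).symm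

lemma bicliqueGraph_adj {n m : ℕ} {x y : Fin n} : (bicliqueGraph n m).Adj x y ↔
    (x.val < m ∧ m ≤ y.val ∧ y.val < 2 * m) ∨ (y.val < m ∧ m ≤ x.val ∧ x.val < 2 * m) := by
  rw [bicliqueGraph, SimpleGraph.fromRel_adj, ne_eq, Fin.ext_iff]
  omega

lemma cliqueGraph_adj {n m : ℕ} {x y : Fin n} : (cliqueGraph n m).Adj x y ↔
    x.val ≠ y.val ∧ x.val < m ∧ y.val < m := by
  rw [cliqueGraph, SimpleGraph.fromRel_adj, ne_eq, Fin.ext_iff]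
  omega

lemma sum_fin_ite_lt (n m : ℕ) (hm : m ≤ n) (c : ℝ) :
    ∑ x : Fin n, (if x.val < m then c else 0) = m * c := by
  rw [Fin.sum_univ_eq_sum_range (fun x => if x < m then c else 0) n, ← Finset.sum_filter,
    Finset.sum_const, nsmul_eq_mul]
  congr 2
  rw [show Finset.filter (fun x => x < m) (Finset.range n) = Finset.range m by ext; simp; omega]
  simp

/-- The indicator vector of `{0, …, m - 1}`. -/
def lowIndicator (n m : ℕ) : Fin n → ℝ := fun x => if x.val < m then 1 else 0

/-- The indicator vector of `{m, …, 2 * m - 1}`. -/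
def midIndicator (n m : ℕ) : Fin n → ℝ := fun x => if m ≤ x.val ∧ x.val < 2 * m then 1 else 0

lemma lowIndicator_dotProduct_self {n m : ℕ} (hm : m ≤ n) :
    lowIndicator n m ⬝ᵥ lowIndicator n m = m := by
  have h := sum_fin_ite_lt n m hm 1
  rw [mul_one] at h
  rw [← h]
  refine Finset.sum_congr rfl fun x _ => ?_
  rw [lowIndicator]
  split_ifs <;> simp

lemma lowIndicator_add_midIndicator (n m : ℕ) :
    lowIndicator n m + midIndicator n m = lowIndicator n (2 * m) := by
  ext x
  simp only [lowIndicator, midIndicator, Pi.add_apply]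
  split_ifs <;> first | omega | simp

lemma lowIndicator_dotProduct_midIndicator (n m : ℕ) :
    lowIndicator n m ⬝ᵥ midIndicator n m = 0 := by
  refine Finset.sum_eq_zero fun x _ => ?_
  simp only [lowIndicator, midIndicator]
  split_ifs <;> first | omega | simp

lemma midIndicator_dotProduct_self {n m : ℕ} (hm : 2 * m ≤ n) :
    midIndicator n m ⬝ᵥ midIndicator n m = m := by
  have h := lowIndicator_dotProduct_self hm
  rw [← lowIndicator_add_midIndicator, dotProduct_add, add_dotProduct, add_dotProduct,
    lowIndicator_dotProduct_self (by omega), lowIndicator_dotProduct_midIndicator,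
    dotProduct_comm (midIndicator n m), lowIndicator_dotProduct_midIndicator] at h
  push_cast at h
  linarith

lemma adjMatrix_bicliqueGraph (n m : ℕ) : (bicliqueGraph n m).adjMatrix ℝ =
    vecMulVec (lowIndicator n m) (midIndicator n m) +
      vecMulVec (midIndicator n m) (lowIndicator n m) := by
  ext x y
  simp only [SimpleGraph.adjMatrix_apply, bicliqueGraph_adj, Matrix.add_apply,
    vecMulVec_apply, lowIndicator, midIndicator]
  split_ifs <;> first | omega | simp

/-- Even powers of the adjacency matrix of `bicliqueGraph n m`. -/
lemma adjMatrix_bicliqueGraph_pow {n m : ℕ} (hm : 2 * m ≤ n) (k : ℕ) :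
    (bicliqueGraph n m).adjMatrix ℝ ^ (2 * (k + 1)) = (m : ℝ) ^ (2 * k + 1) •
      (vecMulVec (lowIndicator n m) (lowIndicator n m) +
        vecMulVec (midIndicator n m) (midIndicator n m)) := by
  have h1 := lowIndicator_dotProduct_self (n := n) (m := m) (by omega)
  have h2 := midIndicator_dotProduct_self hm
  have h3 := lowIndicator_dotProduct_midIndicator n m
  have h4 := (dotProduct_comm (midIndicator n m) (lowIndicator n m)).trans h3
  have hsq : (bicliqueGraph n m).adjMatrix ℝ ^ 2 = (m : ℝ) •
      (vecMulVec (lowIndicator n m) (lowIndicator n m) +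
        vecMulVec (midIndicator n m) (midIndicator n m)) := by
    rw [adjMatrix_bicliqueGraph, sq]
    simp only [Matrix.add_mul, Matrix.mul_add, vecMulVec_mul_vecMulVec, h1, h2, h3, h4]
    simp [vecMulVec_smul, add_comm]
  induction k with
  | zero => simpa using hsq
  | succ k ih =>
    rw [show 2 * (k + 1 + 1) = 2 * (k + 1) + 2 by ring, pow_add, ih, hsq]
    simp only [Matrix.smul_mul, Matrix.mul_smul, Matrix.add_mul, Matrix.mul_add,
      vecMulVec_mul_vecMulVec, h1, h2, h3, h4]
    simp only [vecMulVec_smul, zero_smul, vecMulVec_zero]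
    module

/-- The cycles are even, so the rose is connected and bipartite: there are 2 choices for the part
containing the centre and then `m` for each vertex. -/
lemma homDensity_rose_bicliqueGraph {n m : ℕ} (hm : 2 * m ≤ n) (t k : ℕ) (ht : t ≠ 0) :
    homDensity (rose t (2 * k + 1)) (bicliqueGraph n m) =
      2 * m * ((m : ℝ) ^ (2 * k + 1)) ^ t / (n : ℝ) ^ (t * (2 * k + 1) + 1) := by
  rw [homDensity_rose _ (by omega), show 2 * k + 1 + 1 = 2 * (k + 1) by ring,
    adjMatrix_bicliqueGraph_pow hm]
  congr 1
  rw [show (2 * m : ℝ) = ((2 * m : ℕ) : ℝ) by push_cast; ring, ← sum_fin_ite_lt n (2 * m) hm]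
  refine Finset.sum_congr rfl fun x _ => ?_
  simp only [Matrix.smul_apply, Matrix.add_apply, vecMulVec_apply, lowIndicator, midIndicator,
    smul_eq_mul]
  split_ifs <;> first | omega | simp [ht]

lemma tendsto_natDiv_div (s : ℕ) :
    Tendsto (fun n : ℕ => ((n / s : ℕ) : ℝ) / n) atTop (𝓝 (1 / s)) := by
  have h := (tendsto_nat_floor_mul_div_atTop (R := ℝ) (a := 1 / s) (by positivity)).comp
    tendsto_natCast_atTop_atTop
  refine h.congr fun n => ?_
  simp only [Function.comp_apply]
  rw [one_div_mul_eq_div, Nat.floor_div_eq_div]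

lemma tendsto_homDensity_rose_bicliqueGraph {s : ℕ} (hs : 2 ≤ s) (t k : ℕ) (ht : t ≠ 0) :
    Tendsto (fun n => homDensity (rose t (2 * k + 1)) (bicliqueGraph n (n / s))) atTop
      (𝓝 (2 * (1 / s) ^ (t * (2 * k + 1) + 1))) := by
  refine (((tendsto_natDiv_div s).pow _).const_mul 2).congr fun n => ?_
  have hm : 2 * (n / s) ≤ n := by
    have := Nat.mul_div_le n s
    nlinarith [Nat.mul_le_mul_right (n / s) hs]
  rw [homDensity_rose_bicliqueGraph hm t k ht, div_pow, mul_div_assoc']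
  congr 1
  rw [← pow_mul, mul_assoc, ← pow_succ', mul_comm t]

lemma not_isQuasirandom_bicliqueGraph {s : ℕ} (hs : 0 < s) (hs4 : s ≤ 4) {p : ℝ} (hp : 0 < p) :
    ¬ IsQuasirandom (fun n => bicliqueGraph n (n / s)) p := by
  refine not_isQuasirandom_of_independent hp fun n =>
    ⟨Finset.univ.filter fun x => x.val < n / s, ?_, ?_⟩
  · rw [Fin.card_filter_val_lt]
    exact le_min (Nat.div_le_self _ _) (Nat.div_le_div_left hs4 hs)
  · intro x hx y hy
    simp only [Finset.mem_filter, Finset.mem_univ, true_and] at hx hy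
    simp only [bicliqueGraph, SimpleGraph.fromRel_adj]
    omega

/-- Powers of the adjacency matrix of `cliqueGraph n m`: its eigenvalues are `m - 1`, with the
constant vectors on the clique, and `-1` and `0`. -/
lemma adjMatrix_cliqueGraph_pow {n m : ℕ} (hm : m ≤ n) (k : ℕ) :
    (m : ℝ) • (cliqueGraph n m).adjMatrix ℝ ^ (k + 1) =
      ((m : ℝ) - 1) ^ (k + 1) • vecMulVec (lowIndicator n m) (lowIndicator n m) +
      (-1 : ℝ) ^ (k + 1) • ((m : ℝ) • diagonal (lowIndicator n m) -
        vecMulVec (lowIndicator n m) (lowIndicator n m)) := by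
  -- `J / m` and `D - J / m` are the spectral projections; the factor `m` in the statement avoids
  -- the division.
  set J := vecMulVec (lowIndicator n m) (lowIndicator n m) with hJ
  set D := diagonal (lowIndicator n m) with hD
  have hA : (cliqueGraph n m).adjMatrix ℝ = J - D := by
    ext x y
    simp only [hJ, hD, SimpleGraph.adjMatrix_apply, cliqueGraph_adj, Matrix.sub_apply,
      vecMulVec_apply, lowIndicator, diagonal_apply, Fin.ext_iff]
    split_ifs <;> first | omega | simp
  have hJJ : J * J = (m : ℝ) • J := by
    rw [hJ, vecMulVec_mul_vecMulVec, lowIndicator_dotProduct_self hm, vecMulVec_smul]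
  have hJD : J * D = J := by
    ext x y
    simp only [hD, mul_diagonal, hJ, vecMulVec_apply, lowIndicator]
    split_ifs <;> simp
  have hDD : D * D = D := by
    rw [hD, diagonal_mul_diagonal]
    congr 1
    ext x
    rw [lowIndicator]
    split_ifs <;> simp
  have hDJ : D * J = J := by
    ext x y
    simp only [hD, diagonal_mul, hJ, vecMulVec_apply, lowIndicator]
    split_ifs <;> simp
  induction k with
  | zero =>
    rw [zero_add, pow_one, pow_one, pow_one, hA]
    module
  | succ k ih =>
    rw [pow_succ, ← Matrix.smul_mul, ih, hA]
    simp only [Matrix.add_mul, Matrix.mul_sub, Matrix.sub_mul, Matrix.smul_mul, hJJ, hJD, hDJ, hDD]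
    module

/-- The numerator is the trace: eigenvalue `m - 1` once and `-1` with multiplicity `m - 1`. -/
lemma homDensity_rose_cliqueGraph {n m : ℕ} (hm : m ≤ n) (hm0 : m ≠ 0) (k : ℕ) (hk : 0 < k) :
    homDensity (rose 1 k) (cliqueGraph n m) =
      (((m : ℝ) - 1) ^ (k + 1) + (-1) ^ (k + 1) * (m - 1)) / (n : ℝ) ^ (k + 1) := by
  have hm0' : (m : ℝ) ≠ 0 := Nat.cast_ne_zero.mpr hm0
  rw [homDensity_rose _ hk, one_mul]
  congr 1
  refine mul_left_cancel₀ hm0' ?_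
  rw [Finset.mul_sum, ← sum_fin_ite_lt n m hm]
  refine Finset.sum_congr rfl fun x _ => ?_
  have h := congrFun (congrFun (adjMatrix_cliqueGraph_pow hm k) x) x
  simp only [Matrix.smul_apply, Matrix.add_apply, Matrix.sub_apply, vecMulVec_apply, diagonal_apply_eq,
    smul_eq_mul] at h
  rw [pow_one, h]
  simp only [lowIndicator]
  split_ifs <;> ring

lemma tendsto_homDensity_rose_cliqueGraph (k : ℕ) (hk : 0 < k) :
    Tendsto (fun n => homDensity (rose 1 k) (cliqueGraph n (n / 2))) atTop
      (𝓝 ((1 / 2) ^ (k + 1))) := by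
  have h1 := tendsto_natDiv_div 2
  have h2 : Tendsto (fun n : ℕ => (n : ℝ)⁻¹) atTop (𝓝 0) := tendsto_inv_atTop_nhds_zero_nat
  have h3 := h1.sub h2
  have h := (h3.pow (k + 1)).add ((h3.mul (h2.pow k)).const_mul ((-1) ^ (k + 1)))
  rw [zero_pow hk.ne'] at h
  simp only [Nat.cast_ofNat, sub_zero, mul_zero, add_zero] at h
  refine h.congr' ?_
  filter_upwards [eventually_ge_atTop 2] with n hn
  have hn0 : (n : ℝ) ≠ 0 := Nat.cast_ne_zero.mpr (by omega)
  rw [homDensity_rose_cliqueGraph (by omega) (by omega) k hk, ← one_div, ← sub_div, div_pow,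
    one_div, inv_pow, pow_succ (n : ℝ) k]
  field_simp

lemma not_isQuasirandom_cliqueGraph {p : ℝ} (hp : 0 < p) :
    ¬ IsQuasirandom (fun n => cliqueGraph n (n / 2)) p := by
  refine not_isQuasirandom_of_independent hp fun n =>
    ⟨Finset.univ.filter fun x => ¬ x.val < n / 2, ?_, ?_⟩
  · have h := Finset.card_filter_add_card_filter_not (s := (Finset.univ : Finset (Fin n)))
      (fun x => x.val < n / 2)
    rw [Fin.card_filter_val_lt, Finset.card_univ, Fintype.card_fin] at h
    have := min_le_right n (n / 2)
    omega
  · intro x hx y hy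
    simp only [Finset.mem_filter, Finset.mem_univ, true_and] at hx hy
    simp only [cliqueGraph, SimpleGraph.fromRel_adj]
    omega

/-! ### The three non-forcing pairs -/

lemma exists_pow_eq {k : ℕ} (hk : k ≠ 0) {a : ℝ} (ha0 : 0 < a) (ha1 : a < 1) :
    ∃ p : ℝ, 0 < p ∧ p < 1 ∧ p ^ k = a := by
  refine ⟨a ^ (k⁻¹ : ℝ), by positivity, Real.rpow_lt_one ha0.le ha1 (by positivity), ?_⟩
  exact Real.rpow_inv_natCast_pow ha0.le hk

theorem not_isForcing_rose_one_three_rose_one_five : ¬ IsForcing {rose 1 3, rose 1 5} := by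
  intro hF
  refine not_isQuasirandom_cliqueGraph (by norm_num : (0 : ℝ) < 1 / 2)
    (hF _ _ (by norm_num) (by norm_num) ?_)
  rintro H (rfl | rfl)
  · rw [HasRandomDensity, ncard_edgeSet_rose_one_three]
    exact tendsto_homDensity_rose_cliqueGraph 3 (by norm_num)
  · rw [HasRandomDensity, ncard_edgeSet_rose_one_five]
    exact tendsto_homDensity_rose_cliqueGraph 5 (by norm_num)

theorem not_isForcing_rose_one_three_rose_two_five : ¬ IsForcing {rose 1 3, rose 2 5} := by
  -- With parts of size `n / s` the limits are `2 / s ^ 4` and `2 / s ^ 11`; the cube of the first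
  -- equals the second exactly for `s = 4`.
  obtain ⟨p, hp0, hp1, hp⟩ := exists_pow_eq (k := 4) (by norm_num)
    (by norm_num : (0 : ℝ) < 1 / 128) (by norm_num)
  intro hF
  refine not_isQuasirandom_bicliqueGraph (s := 4) (by norm_num) (by norm_num) hp0
    (hF _ _ hp0 hp1 ?_)
  rintro H (rfl | rfl)
  · rw [HasRandomDensity, ncard_edgeSet_rose_one_three, hp]
    convert tendsto_homDensity_rose_bicliqueGraph (s := 4) (by norm_num) 1 1 (by norm_num) using 2
    norm_num
  · rw [HasRandomDensity, ncard_edgeSet_rose_two_five, show p ^ 12 = (p ^ 4) ^ 3 by ring, hp]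
    convert tendsto_homDensity_rose_bicliqueGraph (s := 4) (by norm_num) 2 2 (by norm_num) using 2
    norm_num

theorem not_isForcing_rose_one_five_rose_two_five : ¬ IsForcing {rose 1 5, rose 2 5} := by
  -- Now `(2 / s ^ 6) ^ 2 = 2 / s ^ 11` gives `s = 2`.
  obtain ⟨p, hp0, hp1, hp⟩ := exists_pow_eq (k := 6) (by norm_num)
    (by norm_num : (0 : ℝ) < 1 / 32) (by norm_num)
  intro hF
  refine not_isQuasirandom_bicliqueGraph (s := 2) (by norm_num) (by norm_num) hp0
    (hF _ _ hp0 hp1 ?_)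
  rintro H (rfl | rfl)
  · rw [HasRandomDensity, ncard_edgeSet_rose_one_five, hp]
    convert tendsto_homDensity_rose_bicliqueGraph (s := 2) (by norm_num) 1 2 (by norm_num) using 2
    norm_num
  · rw [HasRandomDensity, ncard_edgeSet_rose_two_five, show p ^ 12 = (p ^ 6) ^ 2 by ring, hp]
    convert tendsto_homDensity_rose_bicliqueGraph (s := 2) (by norm_num) 2 2 (by norm_num) using 2
    norm_num

lemma isEmpty_rose_iso {t k t' k' : ℕ} (h : t * k ≠ t' * k') :
    IsEmpty ((rose t k).graph ≃g (rose t' k').graph) := by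
  refine ⟨fun e => h ?_⟩
  have := Fintype.card_congr e.toEquiv
  rw [card_rose, card_rose] at this
  omega

end ForcingTriples

theorem mainTheorem1 :
    ∃ H₁ H₂ H₃ : ForcingTriples.FiniteGraph,
      (H₁.graph.Connected ∧ H₂.graph.Connected ∧ H₃.graph.Connected) ∧
      (IsEmpty (H₁.graph ≃g H₂.graph) ∧ IsEmpty (H₁.graph ≃g H₃.graph) ∧
        IsEmpty (H₂.graph ≃g H₃.graph)) ∧
      ForcingTriples.IsForcing {H₁, H₂, H₃} ∧
      ¬ ForcingTriples.IsForcing {H₁, H₂} ∧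
      ¬ ForcingTriples.IsForcing {H₁, H₃} ∧
      ¬ ForcingTriples.IsForcing {H₂, H₃} := by
  open ForcingTriples in
  exact ⟨rose 1 3, rose 1 5, rose 2 5,
    ⟨connected_roseGraph (by norm_num), connected_roseGraph (by norm_num),
      connected_roseGraph (by norm_num)⟩,
    ⟨isEmpty_rose_iso (by norm_num), isEmpty_rose_iso (by norm_num),
      isEmpty_rose_iso (by norm_num)⟩,
    isForcing_roses, not_isForcing_rose_one_three_rose_one_five,
    not_isForcing_rose_one_three_rose_two_five, not_isForcing_rose_one_five_rose_two_five⟩
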